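/- Let $\sigma>0$. There is a constant $C$ depending only on $\sigma$ such that the following holds. Setting. Let $G\subset\mathbb{R}^2\cong\partial\mathbb{R}^3_+$ be a bounded Lipschitz domain and $\mu>0$. For a distribution $u$ on $\mathbb{R}\times\mathbb{R}^2$ such that $e^{-\sigma t}u$ is tempered, let $\hat u(\omega,\xi')$, $\omega=\xi_0+i\sigma$, denote the Fourier transform of $e^{-\sigma t}u$ (kernel $e^{i\xi_0t-i\xi'\cdot x}$, normalized to be unitary), and put $$\|u\|_{s,r,\sigma,*}=\Big(\int_{\mathrm{Im}\,\omega=\sigma}|\omega|^{2s}\int_{\mathbb{R}^2}(|\omega|^2+|\xi'|^2)^{r}\,|\hat u(\omega,\xi')|^2\,d\xi'\,d\omega\Big)^{1/2}.$$ $H^s_\sigma(\mathbb{R}^+,\tilde H^r(G))$ is the space of such $u$ with $\operatorname{supp}u\subset[0,\infty)\times\overline G$ and $\|u\|_{s,r,\sigma,*}<\infty$. $H^s_\sigma(\mathbb{R}^+,H^r(G))$ is the space of restrictions to $\mathbb{R}\times G$ of distributions on $\mathbb{R}\times\mathbb{R}^2$ for which this norm is finite and which vanish on $(-\infty,0)\times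 G$. Let $\langle f,v\rangle_\sigma=\int\hat f\,\overline{\hat v}$ be the duality which extends $\int_0^\infty e^{-2\sigma t}\int f\bar v\,dx\,dt$, where an element $f$ of a space of restrictions is replaced by any of its extensions of finite norm to $\mathbb{R}\times\mathbb{R}^2$. Let $\mathcal{S}_\sigma$ be the Dirichlet-to-Neumann operator of the wave equation in the half-space $\mathbb{R}^3_+$ (wave speed $1$), given by $\widehat{\mathcal{S}_\sigma u}=-i\mu\sqrt{\omega^2-|\xi'|^2}\;\hat u$ with the branch $\mathrm{Im}\sqrt{\omega^2-|\xi'|^2}>0$, and let $p_Q$ be the restriction to $Q=\mathbb{R}\times G$. Discretization. Let $p,q\ge1$, $\Delta t>0$, and let $\mathcal{T}$ be a finite conforming triangulation of $\overline G$. $V^p_t$ consists of the continuous functions of $t$ that vanish for $t\le0$ and are polynomials of degree at most $p$ on each interval $[n\Delta t,(n+1)\Delta t]$, $n=0,1,2,\dots$; if only a finite number $N$ of time steps is used, they also vanish for $t\ge N\Delta t$. $\tilde V^q_h$ consists of the continuous functions on $\mathbb{R}^2$ that vanish outside $G$ and are polynomials of degree at most $q$ on each triangle of $\mathcal{T}$.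 Let $\tilde V^{p,q}_{t,h}$ be the space of those functions in the algebraic tensor product $V^p_t\otimes\tilde V^q_h$ that belong to $H^{1/2}_\sigma(\mathbb{R}^+,\tilde H^{1/2}(G))$ (all of them, if $N$ is finite). Statement. Let $h\in H^{1/2}_\sigma(\mathbb{R}^+,H^{-1/2}(G))$, let $u\in H^{1/2}_\sigma(\mathbb{R}^+,\tilde H^{1/2}(G))$ be a solution of $$\langle p_Q\mathcal{S}_\sigma u,v\rangle_\sigma=\langle h,v\rangle_\sigma\qquad\text{for all }v\in H^{-1/2}_\sigma(\mathbb{R}^+,\tilde H^{1/2}(G)),$$ and let $u_{\Delta t,h}\in\tilde V^{p,q}_{t,h}$ be a solution of $$\langle p_Q\mathcal{S}_\sigma u_{\Delta t,h},\phi_{\Delta t,h}\rangle_\sigma=\langle h,\phi_{\Delta t,h}\rangle_\sigma\qquad\text{for all }\phi_{\Delta t,h}\in\tilde V^{p,q}_{t,h}.$$ Then $$\|u-u_{\Delta t,h}\|_{-\frac12,\frac12,\sigma,*}\;\le\;C\inf_{\phi_{\Delta t,h}\in\tilde V^{p,q}_{t,h}}\|u-\phi_{\Delta t,h}\|_{\frac12,\frac12,\sigma,*}.$$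 -/

import Mathlib

open MeasureTheory TopologicalSpace Distribution
open scoped Distributions SchwartzMap FourierTransform ENNReal NNReal ComplexConjugate

noncomputable section

namespace TDBEM

/-- The flat boundary `Γ = ∂ℝ³₊ ≅ ℝ²`. -/
abbrev Plane : Type := EuclideanSpace ℝ (Fin 2)

/-- Space-time on the boundary, `ℝ × ℝ²`, points `z = (t, x)` with `t = z.fst`, `x = z.snd`.
The Euclidean (`L²`) product makes the Fourier transform of Mathlib available. -/
abbrev SpaceTime : Type := WithLp 2 (ℝ × Plane)

/-- Complex valued distributions on `ℝ × ℝ²`. -/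
abbrev Dist : Type := 𝓓'((⊤ : Opens SpaceTime), ℂ)

/-! ### Domains -/

/-- `G` is a Lipschitz domain: near every boundary point, after a rigid motion, it is the strict
subgraph of a Lipschitz function. -/
def IsLipschitzDomain (G : Set Plane) : Prop :=
  IsOpen G ∧ ∀ x ∈ frontier G, ∃ (e : Plane ≃ᵃⁱ[ℝ] Plane) (f : ℝ → ℝ) (L : ℝ≥0),
    LipschitzWith L f ∧ ∀ᶠ y in nhds x, (y ∈ G ↔ (e y) 1 < f ((e y) 0))

/-! ### Fourier-Laplace transform and the space-time Sobolev spaces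

For a distribution `u` on `ℝ × ℝ²` and `σ > 0` the Fourier-Laplace transform on the line
`Im ω = σ` is the Fourier transform of `e^{-σt} u`. Mathlib's Fourier transform has the kernel
`exp (-2πi ⟨z, ζ⟩)`, so that the frequency variable `ζ = (ζ.fst, ζ.snd)` stands for
`ω = -2π ζ.fst + iσ` (as `exp (iωt) = exp (-σt) exp (-2πi t ζ.fst)`) and `ξ' = 2π ζ.snd`.
This normalization of the Fourier transform is unitary; it changes all the norms below by one and
the same factor compared with the kernel `exp (-i ⟨z, ζ⟩)`. -/

/-- The complex frequency `ω = ξ₀ + iσ`, with `ξ₀ = -2π ζ.fst`. -/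
def freq (σ : ℝ) (ζ : SpaceTime) : ℂ := ((-(2 * Real.pi * ζ.fst) : ℝ) : ℂ) + (σ : ℂ) * Complex.I

/-- The length `|ξ'|` of the spatial frequency `ξ' = 2π ζ.snd`. -/
def waveNumber (ζ : SpaceTime) : ℝ := 2 * Real.pi * ‖ζ.snd‖

/-- The tempered distribution `U` is `e^{-σt} u`: `U(ψ) = u(e^{-σt} ψ)` for all test functions
`ψ = e^{σt} φ`, `φ ∈ C_c^∞`. -/
def IsExpWeighted (σ : ℝ) (u : Dist) (U : 𝓢'(SpaceTime, ℂ)) : Prop :=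
  ∀ (φ : 𝓓((⊤ : Opens SpaceTime), ℝ)) (ψ : 𝓢(SpaceTime, ℂ)),
    (∀ z : SpaceTime, ψ z = ((Real.exp (σ * z.fst) * φ z : ℝ) : ℂ)) → U ψ = u φ

/-- `e^{-σt} u` is tempered and its Fourier transform is the function `F`; that is, `F` is the
Fourier-Laplace transform `û(ξ₀ + iσ, ξ')` of `u`. -/
def IsLaplaceTransform (σ : ℝ) (u : Dist) (F : SpaceTime → ℂ) : Prop :=
  ∃ U : 𝓢'(SpaceTime, ℂ), IsExpWeighted σ u U ∧ AEStronglyMeasurable F volume ∧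
    ∀ ψ : 𝓢(SpaceTime, ℂ), Integrable (fun ζ => F ζ * ψ ζ) volume ∧ 𝓕 U ψ = ∫ ζ, F ζ * ψ ζ

open Classical in
/-- The Fourier-Laplace transform `û(ξ₀ + iσ, ξ')`, unique up to null sets where it exists. -/
def laplace (σ : ℝ) (u : Dist) : SpaceTime → ℂ :=
  if h : ∃ F, IsLaplaceTransform σ u F then h.choose else 0

/-- The weight `|ω|^{2s} (|ω|² + |ξ'|²)^r`. -/
def sobolevWeight (σ s r : ℝ) (ζ : SpaceTime) : ℝ :=
  ‖freq σ ζ‖ ^ (2 * s) * (‖freq σ ζ‖ ^ 2 + waveNumber ζ ^ 2) ^ r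

/-- The norm
`‖u‖_{s,r,σ,*} = (∫_{Im ω = σ} |ω|^{2s} ∫ (|ω|² + |ξ'|²)^r |û(ω, ξ')|² dξ' dω)^{1/2}`,
with the value `∞` if `û` does not exist as a function. -/
def sobolevNorm (σ s r : ℝ) (u : Dist) : ℝ≥0∞ :=
  ⨅ (F : SpaceTime → ℂ) (_ : IsLaplaceTransform σ u F),
    (∫⁻ ζ, ENNReal.ofReal (sobolevWeight σ s r ζ * ‖F ζ‖ ^ 2)) ^ (1 / 2 : ℝ)

/-- The space `H^s_σ(ℝ⁺, H̃^r(G))`. Its elements are identified with their extensions by zero,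
that is, with distributions on `ℝ × ℝ²` supported in `[0,∞) × closure G`. -/
def HTilde (σ s r : ℝ) (G : Set Plane) : Set Dist :=
  {u | dsupport u ⊆ {z : SpaceTime | 0 ≤ z.fst ∧ z.snd ∈ closure G} ∧ sobolevNorm σ s r u < ⊤}

/-- The space `H^s_σ(ℝ⁺, H^r(G))`, where `H^r(G) = H^r(ℝ²) / H̃^r(ℝ² ∖ closure G)`, given by the
representatives of its elements: distributions `h` on `ℝ × ℝ²` of finite norm whose restriction
to `ℝ × G` is supported in `{t ≥ 0}`. Two representatives define the same element if they agree
on `ℝ × G`. -/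
def HQuot (σ s r : ℝ) (G : Set Plane) : Set Dist :=
  {h | IsVanishingOn h {z : SpaceTime | z.fst < 0 ∧ z.snd ∈ G} ∧ sobolevNorm σ s r h < ⊤}

/-! ### The duality and the Dirichlet-to-Neumann operator -/

/-- The extension by continuity of `⟨f, v⟩_σ = ∫₀^∞ e^{-2σt} ∫ f v̄ dx dt` to the duality between
`H^s_σ(ℝ⁺, H^r(G))` and `H^{-s}_σ(ℝ⁺, H̃^{-r}(G))`, for (a representative of) `f` with the
Fourier-Laplace transform `F`. -/
def pairing (σ : ℝ) (F : SpaceTime → ℂ) (v : Dist) : ℂ :=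
  ∫ ζ, F ζ * conj (laplace σ v ζ)

/-- `Γ(ω, ξ') = √(ω² - |ξ'|²)` (with wave speed `c_s = 1`), `ω = ξ₀ + iσ`, with the branch of the
square root with positive imaginary part, that is, `Γ ≈ ω` for `|ω| ≫ |ξ'|`. -/
def dispersion (σ : ℝ) (ζ : SpaceTime) : ℂ :=
  Complex.I * ((waveNumber ζ : ℂ) ^ 2 - freq σ ζ ^ 2) ^ (1 / 2 : ℂ)

/-- The Fourier-Laplace transform of `S_σ u`, where `S_σ` is the Dirichlet-to-Neumann operator
of the half-space, `S_σ w|_Γ = -μ ∂w/∂ν|_Γ`, with the symbol `-iμΓ(ξ₀ + iσ, ξ')`. -/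
def dtnTransform (σ μ : ℝ) (u : Dist) (ζ : SpaceTime) : ℂ :=
  -Complex.I * (μ : ℂ) * dispersion σ ζ * laplace σ u ζ

/-- The sesquilinear form `⟨p_Q S_σ u, v⟩_σ`. The restriction `p_Q S_σ u` to `Q = ℝ × G` is the
element of `H^s_σ(ℝ⁺, H^{-1/2}(G))` represented by `S_σ u`. -/
def dtnForm (σ μ : ℝ) (u v : Dist) : ℂ := pairing σ (dtnTransform σ μ u) v

/-- The sesquilinear form `⟨h, v⟩_σ`. -/
def loadForm (σ : ℝ) (h v : Dist) : ℂ := pairing σ (laplace σ h) v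

/-! ### Discretization -/

/-- `K` is a triangulation of `G`: finitely many closed nondegenerate triangles with their edges
and vertices, any two of which meet in a common face or not at all, covering `closure G`. -/
def IsTriangulation (K : Geometry.SimplicialComplex ℝ Plane) (G : Set Plane) : Prop :=
  K.faces.Finite ∧ K.space = closure G

/-- `V_t^p` for `p ≥ 1`: continuous functions of `t` vanishing for `t ≤ 0`, which are polynomials
of degree at most `p` on each interval `[n Δt, (n+1) Δt]`, and which vanish after the last of the
`N` time steps if `N` is finite. -/
def TimeSpace (dt : ℝ) (N : ℕ∞) (p : ℕ) : Set (ℝ → ℂ) :=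
  {v | Continuous v ∧ (∀ t ≤ 0, v t = 0) ∧
    (∀ n : ℕ, ∃ P : Polynomial ℂ, P.natDegree ≤ p ∧
      ∀ t ∈ Set.Icc (n * dt) ((n + 1) * dt), v t = P.eval (t : ℂ)) ∧
    ∀ M : ℕ, N ≤ (M : ℕ∞) → ∀ t ≥ M * dt, v t = 0}

/-- `Ṽ_h^q(G)` for `q ≥ 1`: continuous functions of `x` vanishing on `∂G` (and extended by zero
outside of `G`), which are polynomials of degree at most `q` on each triangle. -/
def SpatialSpace (K : Geometry.SimplicialComplex ℝ Plane) (G : Set Plane) (q : ℕ) :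
    Set (Plane → ℂ) :=
  {ψ | Continuous ψ ∧ (∀ x ∉ G, ψ x = 0) ∧
    ∀ S ∈ K.faces, S.card = 3 → ∃ P : MvPolynomial (Fin 2) ℂ, P.totalDegree ≤ q ∧
      ∀ x ∈ convexHull ℝ (S : Set Plane), ψ x = MvPolynomial.eval (fun i => (x i : ℂ)) P}

/-- The algebraic tensor product `V_t^p ⊗ Ṽ_h^q` as a space of functions of `(t, x)`. -/
def TensorSpace (K : Geometry.SimplicialComplex ℝ Plane) (G : Set Plane) (dt : ℝ) (N : ℕ∞)
    (p q : ℕ) : Submodule ℂ (SpaceTime → ℂ) :=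
  Submodule.span ℂ {w | ∃ v ∈ TimeSpace dt N p, ∃ ψ ∈ SpatialSpace K G q,
    w = fun z : SpaceTime => v z.fst * ψ z.snd}

/-- The ansatz and test space `Ṽ^{p,q}_{t,h} ⊂ H^{1/2}_σ(ℝ⁺, H̃^{1/2}(G))`. For finitely many time
steps every function in the tensor product belongs to `H^{1/2}_σ(ℝ⁺, H̃^{1/2}(G))`; for
infinitely many time steps this excludes too rapid growth as `t → ∞`. -/
def DiscreteSpace (σ : ℝ) (K : Geometry.SimplicialComplex ℝ Plane) (G : Set Plane) (dt : ℝ)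
    (N : ℕ∞) (p q : ℕ) : Set Dist :=
  {u | u ∈ HTilde σ (1 / 2) (1 / 2) G ∧ ∃ w ∈ TensorSpace K G dt N p q,
    ∀ φ : 𝓓((⊤ : Opens SpaceTime), ℝ), u φ = ∫ z, (φ z : ℂ) * w z}

/-! ### The variational equality and its Galerkin discretization -/

/-- `u` solves `p_Q S_σ u = h`: `u ∈ H^{1/2}_σ(ℝ⁺, H̃^{1/2}(G))` and
`⟨p_Q S_σ u, v⟩_σ = ⟨h, v⟩_σ` for all `v ∈ H^{-1/2}_σ(ℝ⁺, H̃^{1/2}(G))`. -/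
def IsContinuousSolution (σ μ : ℝ) (G : Set Plane) (h u : Dist) : Prop :=
  u ∈ HTilde σ (1 / 2) (1 / 2) G ∧
    ∀ v ∈ HTilde σ (-1 / 2) (1 / 2) G, dtnForm σ μ u v = loadForm σ h v

/-- `u` is a Galerkin solution: `u ∈ Ṽ^{p,q}_{t,h}` and `⟨p_Q S_σ u, φ⟩_σ = ⟨h, φ⟩_σ` for all
`φ ∈ Ṽ^{p,q}_{t,h}`. -/
def IsGalerkinSolution (σ μ : ℝ) (K : Geometry.SimplicialComplex ℝ Plane) (G : Set Plane)
    (dt : ℝ) (N : ℕ∞) (p q : ℕ) (h u : Dist) : Prop :=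
  u ∈ DiscreteSpace σ K G dt N p q ∧
    ∀ φ ∈ DiscreteSpace σ K G dt N p q, dtnForm σ μ u φ = loadForm σ h φ

end TDBEM

end

/-! The Fourier-Laplace transform turns the form `dtnForm` into integration against the symbol `μ
z`, where `z² = k² - ω²`, `Re z ≥ 0` and `k = |ξ'|`. Two pointwise estimates carry the proof.

Upper bound: `|z| ≤ (|ω|² + k²)^{1/2}`, which is the geometric mean of the weights for `s = 1/2` and
`s = -1/2`. By Cauchy-Schwarz the form is bounded by `μ` times the product of the corresponding
norms (`enorm_dtnForm_le`).

Lower bound: `Re z ≥ (σ/√3) |ω|⁻¹ (|ω|² + k²)^{1/2}`, so the form is coercive, but only in the norm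
with `s = -1/2` (`le_enorm_dtnForm_self`). This loss of one power of `|ω|` is why the two sides of
the theorem carry different norms.

The rest is Céa's argument. Galerkin orthogonality tested with `uh - φ` gives `‖uh - φ‖ ≤ (√3/σ) ‖u
- φ‖`, with `s = -1/2` on the left and `s = 1/2` on the right; `μ` cancels. The triangle inequality
and `|ω| ≥ σ` finish.

Since `laplace` is defined by choice, its additivity needs uniqueness of the transform up to null
sets, which rests on the density of compactly supported functions in the Schwartz space. -/

namespace TDBEM

/-! ### Density of compactly supported Schwartz functions -/

section Density

variable {E : Type*} [NormedAddCommGroup E] [InnerProductSpace ℝ E]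

/-- Rescaling by `a` multiplies a derivative of order `j` by `a ^ j`, so the bound is uniform for
`|a| ≤ 1`. -/
theorem exists_bound_iteratedFDeriv_one_sub {χ : E → ℂ} (hχ : ContDiff ℝ (⊤ : ℕ∞) χ)
    (hc : HasCompactSupport χ) (j : ℕ) :
    ∃ C : ℝ, 0 ≤ C ∧ ∀ a : ℝ, |a| ≤ 1 → ∀ x : E,
      ‖iteratedFDeriv ℝ j (fun y => 1 - χ (a • y)) x‖ ≤ C := by
  set S : 𝓢(E, ℂ) := hc.toSchwartzMap hχ with hS
  refine ⟨1 + SchwartzMap.seminorm ℝ 0 j S, by positivity, fun a ha x => ?_⟩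
  have h1 : ContDiff ℝ j χ := hχ.of_le (by exact_mod_cast le_top)
  have h2 : ContDiff ℝ j (fun y => χ (a • y)) := h1.comp (contDiff_const_smul a)
  have e : iteratedFDeriv ℝ j (fun y => 1 - χ (a • y)) x
      = iteratedFDeriv ℝ j (fun _ : E => (1 : ℂ)) x
        - iteratedFDeriv ℝ j (fun y => χ (a • y)) x :=
    iteratedFDeriv_sub_apply contDiff_const.contDiffAt h2.contDiffAt
  rw [e]
  refine (norm_sub_le _ _).trans (add_le_add ?_ ?_)
  · rcases Nat.eq_zero_or_pos j with rfl | hj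
    · simp
    · rw [iteratedFDeriv_const_of_ne hj.ne']; simp
  · rw [iteratedFDeriv_comp_const_smul a h1]
    rw [norm_smul, norm_pow, Real.norm_eq_abs]
    have h3 : ‖iteratedFDeriv ℝ j χ (a • x)‖ ≤ SchwartzMap.seminorm ℝ 0 j S := by
      have := S.norm_iteratedFDeriv_le_seminorm ℝ j (a • x)
      exact this
    calc |a| ^ j * ‖iteratedFDeriv ℝ j χ (a • x)‖
        ≤ 1 * ‖iteratedFDeriv ℝ j χ (a • x)‖ := by
          gcongr; exact pow_le_one₀ (abs_nonneg a) ha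
      _ ≤ _ := by rw [one_mul]; exact h3

variable [FiniteDimensional ℝ E]

theorem exists_cutoff :
    ∃ χ : E → ℂ, ContDiff ℝ (⊤ : ℕ∞) χ ∧ HasCompactSupport χ ∧ ∀ x, ‖x‖ ≤ 1 → χ x = 1 := by
  let b : ContDiffBump (0 : E) := ⟨1, 2, one_pos, one_lt_two⟩
  refine ⟨fun x => ((b x : ℝ) : ℂ), Complex.ofRealCLM.contDiff.comp b.contDiff,
    b.hasCompactSupport.comp_left (g := fun r : ℝ => (r : ℂ)) (by simp), fun x hx => ?_⟩
  have : b x = 1 := b.one_of_mem_closedBall (by simpa [b] using hx)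
  simp [this]

/-- Compactly supported Schwartz functions are dense in the Schwartz space. -/
theorem exists_seq_hasCompactSupport_tendsto (ψ : 𝓢(E, ℂ)) :
    ∃ f : ℕ → 𝓢(E, ℂ), (∀ n, HasCompactSupport (f n)) ∧
      Filter.Tendsto f Filter.atTop (nhds ψ) := by
  obtain ⟨χ, hχ, hc, h1⟩ := exists_cutoff (E := E)
  set a : ℕ → ℝ := fun n => ((n : ℝ) + 1)⁻¹ with ha
  have ha0 : ∀ n, 0 < a n := fun n => by positivity
  have ha1 : ∀ n, |a n| ≤ 1 := fun n => by
    rw [abs_of_pos (ha0 n)]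
    exact inv_le_one_of_one_le₀ (by linarith [(Nat.cast_nonneg n : (0 : ℝ) ≤ n)])
  have hcs : ∀ n, HasCompactSupport (fun y : E => χ (a n • y)) := fun n =>
    hc.comp_homeomorph (Homeomorph.smulOfNeZero (a n) (ha0 n).ne')
  have hsm : ∀ n, ContDiff ℝ (⊤ : ℕ∞) (fun y : E => χ (a n • y)) := fun n =>
    hχ.comp (contDiff_const_smul (a n))
  have hcs' : ∀ n, HasCompactSupport (fun y : E => χ (a n • y) * ψ y) := fun n =>
    (hcs n).mul_right
  have hsm' : ∀ n, ContDiff ℝ (⊤ : ℕ∞) (fun y : E => χ (a n • y) * ψ y) := fun n =>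
    (hsm n).mul (ψ.smooth ⊤)
  refine ⟨fun n => (hcs' n).toSchwartzMap (hsm' n), fun n => hcs' n, ?_⟩
  rw [(schwartz_withSeminorms ℝ E ℂ).tendsto_nhds_atTop]
  rintro ⟨k, l⟩ ε hε
  choose C hC0 hC using fun j => exists_bound_iteratedFDeriv_one_sub hχ hc j
  set M : ℝ := ∑ i ∈ Finset.range (l + 1),
    (l.choose i : ℝ) * C i * SchwartzMap.seminorm ℝ (k + 1) (l - i) ψ with hM
  have hM0 : 0 ≤ M := Finset.sum_nonneg fun i _ =>
    mul_nonneg (mul_nonneg (Nat.cast_nonneg _) (hC0 i)) (apply_nonneg _ _)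
  obtain ⟨n₀, hn₀⟩ := exists_nat_gt (M / ε)
  refine ⟨n₀, fun n hn => ?_⟩
  -- The error `(1 - χ(a y)) ψ` vanishes for `‖y‖ < 1/a`. Where it does not, `1 ≤ a ‖x‖`, and
  -- spending one more power of `‖x‖` on `ψ` gains the factor `a`.
  have hle : SchwartzMap.seminorm ℝ k l ((hcs' n).toSchwartzMap (hsm' n) - ψ) ≤ a n * M := by
    refine SchwartzMap.seminorm_le_bound ℝ k l _ (mul_nonneg (ha0 n).le hM0) fun x => ?_
    have hfun : (((hcs' n).toSchwartzMap (hsm' n) - ψ : 𝓢(E, ℂ)) : E → ℂ)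
        = fun y => -((1 - χ (a n • y)) * ψ y) := by
      ext y
      change χ (a n • y) * ψ y - ψ y = _
      ring
    have hg : ContDiff ℝ (⊤ : ℕ∞) (fun y : E => 1 - χ (a n • y)) := contDiff_const.sub (hsm n)
    rw [hfun, show iteratedFDeriv ℝ l (fun y => -((1 - χ (a n • y)) * ψ y)) x
      = -iteratedFDeriv ℝ l (fun y => (1 - χ (a n • y)) * ψ y) x from
        iteratedFDeriv_neg_apply, norm_neg]
    by_cases hx : ‖x‖ < (n : ℝ) + 1
    · have hz : (fun y => (1 - χ (a n • y)) * ψ y) =ᶠ[nhds x] fun _ => 0 := by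
        have : ∀ᶠ y in nhds x, ‖y‖ < (n : ℝ) + 1 :=
          (continuous_norm.isOpen_preimage _ isOpen_Iio).mem_nhds hx
        filter_upwards [this] with y hy
        rw [h1, sub_self, zero_mul]
        rw [norm_smul, Real.norm_eq_abs, abs_of_pos (ha0 n), ha]
        rw [inv_mul_le_iff₀ (by positivity), mul_one]
        exact hy.le
      rw [(Filter.EventuallyEq.iteratedFDeriv ℝ hz l).eq_of_nhds]
      simp only [iteratedFDeriv_fun_zero, Pi.zero_apply, norm_zero, mul_zero]
      exact mul_nonneg (ha0 n).le hM0
    · push Not at hx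
      have hb := norm_iteratedFDeriv_mul_le hg (ψ.smooth ⊤) x (n := l) (by exact_mod_cast le_top)
      calc ‖x‖ ^ k * ‖iteratedFDeriv ℝ l (fun y => (1 - χ (a n • y)) * ψ y) x‖
          ≤ ‖x‖ ^ k * ∑ i ∈ Finset.range (l + 1), (l.choose i : ℝ)
              * ‖iteratedFDeriv ℝ i (fun y => 1 - χ (a n • y)) x‖
              * ‖iteratedFDeriv ℝ (l - i) ψ x‖ := by gcongr
        _ ≤ a n * M := by
          rw [hM, Finset.mul_sum, Finset.mul_sum]
          refine Finset.sum_le_sum fun i _ => ?_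
          have hs := ψ.le_seminorm ℝ (k + 1) (l - i) x
          have hax : 1 ≤ a n * ‖x‖ := by
            rw [ha]; rw [le_inv_mul_iff₀ (by positivity), mul_one]; exact hx
          have h5 : ‖x‖ ^ k * ‖iteratedFDeriv ℝ (l - i) ψ x‖
              ≤ a n * SchwartzMap.seminorm ℝ (k + 1) (l - i) ψ := by
            calc ‖x‖ ^ k * ‖iteratedFDeriv ℝ (l - i) ψ x‖
                ≤ (a n * ‖x‖) * (‖x‖ ^ k * ‖iteratedFDeriv ℝ (l - i) ψ x‖) :=
                  le_mul_of_one_le_left (by positivity) hax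
              _ = a n * (‖x‖ ^ (k + 1) * ‖iteratedFDeriv ℝ (l - i) ψ x‖) := by ring
              _ ≤ _ := mul_le_mul_of_nonneg_left hs (ha0 n).le
          calc ‖x‖ ^ k * ((l.choose i : ℝ) * ‖iteratedFDeriv ℝ i (fun y => 1 - χ (a n • y)) x‖
              * ‖iteratedFDeriv ℝ (l - i) ψ x‖)
              = (l.choose i : ℝ) * ‖iteratedFDeriv ℝ i (fun y => 1 - χ (a n • y)) x‖
              * (‖x‖ ^ k * ‖iteratedFDeriv ℝ (l - i) ψ x‖) := by ring
            _ ≤ (l.choose i : ℝ) * C i * (a n * SchwartzMap.seminorm ℝ (k + 1) (l - i) ψ) := by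
                gcongr
                · exact mul_nonneg (Nat.cast_nonneg _) (hC0 i)
                · exact hC i (a n) (ha1 n) x
            _ = _ := by ring
  refine lt_of_le_of_lt hle ?_
  rw [ha]
  rw [inv_mul_lt_iff₀ (by positivity)]
  rw [div_lt_iff₀ hε] at hn₀
  have : (n₀ : ℝ) ≤ n := by exact_mod_cast hn
  nlinarith

end Density

/-! ### Uniqueness and additivity of the Fourier-Laplace transform -/

theorem IsExpWeighted.apply_eq_zero {σ : ℝ} {U : 𝓢'(SpaceTime, ℂ)}
    (hU : IsExpWeighted σ 0 U) (ψ : 𝓢(SpaceTime, ℂ)) : U ψ = 0 := by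
  have hexp : ContDiff ℝ (⊤ : ℕ∞) (fun z : SpaceTime => Real.exp (-(σ * z.fst))) := by
    have : ContDiff ℝ (⊤ : ℕ∞) (fun z : SpaceTime => z.fst) :=
      (WithLp.fstL 2 ℝ ℝ Plane).contDiff
    fun_prop
  -- Test functions of `Dist` are real and compactly supported, so real and imaginary parts are
  -- treated separately, with `e^{-σt} L ψ` as the test function.
  have real : ∀ (L : ℂ →L[ℝ] ℝ) (ψ : 𝓢(SpaceTime, ℂ)), HasCompactSupport ψ →
      U (SchwartzMap.postcompCLM Complex.ofRealCLM (SchwartzMap.postcompCLM L ψ)) = 0 := by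
    intro L ψ hψ
    have hc : HasCompactSupport (fun z : SpaceTime => Real.exp (-(σ * z.fst)) * L (ψ z)) :=
      (hψ.comp_left (map_zero L)).mul_left
    have hs : ContDiff ℝ (⊤ : ℕ∞) (fun z : SpaceTime => Real.exp (-(σ * z.fst)) * L (ψ z)) :=
      hexp.mul (L.contDiff.comp (ψ.smooth ⊤))
    refine (hU ⟨_, hs, hc, by simp⟩ _ fun z => ?_).trans (by simp)
    change ((L (ψ z) : ℝ) : ℂ)
      = ((Real.exp (σ * z.fst) * (Real.exp (-(σ * z.fst)) * L (ψ z)) : ℝ) : ℂ)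
    rw [← mul_assoc, ← Real.exp_add]
    simp
  have cpt : ∀ ψ : 𝓢(SpaceTime, ℂ), HasCompactSupport ψ → U ψ = 0 := by
    intro ψ hψ
    have e : ψ = SchwartzMap.postcompCLM Complex.ofRealCLM (SchwartzMap.postcompCLM Complex.reCLM ψ)
        + Complex.I • SchwartzMap.postcompCLM Complex.ofRealCLM
          (SchwartzMap.postcompCLM Complex.imCLM ψ) := by
      ext z
      change ψ z = ((ψ z).re : ℂ) + Complex.I * ((ψ z).im : ℂ)
      rw [mul_comm, Complex.re_add_im]
    rw [e, map_add, map_smul, real _ ψ hψ, real _ ψ hψ, smul_zero, add_zero]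
  obtain ⟨f, hf, hlim⟩ := exists_seq_hasCompactSupport_tendsto ψ
  have h := (U.continuous.tendsto ψ).comp hlim
  exact tendsto_nhds_unique h (tendsto_const_nhds.congr fun n => (cpt _ (hf n)).symm)

theorem IsLaplaceTransform.sub {σ : ℝ} {u v : Dist} {F H : SpaceTime → ℂ}
    (hF : IsLaplaceTransform σ u F) (hH : IsLaplaceTransform σ v H) :
    IsLaplaceTransform σ (u - v) (F - H) := by
  obtain ⟨U, hU, mF, iF⟩ := hF
  obtain ⟨V, hV, mH, iH⟩ := hH
  refine ⟨U - V, fun φ ψ h => ?_, mF.sub mH, fun ψ => ?_⟩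
  · change U ψ - V ψ = u φ - v φ
    rw [hU φ ψ h, hV φ ψ h]
  · have e : (fun ζ => (F - H) ζ * ψ ζ) = fun ζ => F ζ * ψ ζ - H ζ * ψ ζ := by
      ext ζ; simp [sub_mul]
    rw [e]
    refine ⟨(iF ψ).1.sub (iH ψ).1, ?_⟩
    rw [integral_sub (iF ψ).1 (iH ψ).1, ← (iF ψ).2, ← (iH ψ).2]
    rfl

/-- The tempered distribution behind `F` is zero, hence so is its Fourier transform, and the
fundamental lemma of the calculus of variations applies. Local integrability of `F` comes from its
integrability against a cutoff equal to `1` on the given compact set. -/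
theorem IsLaplaceTransform.ae_eq_zero {σ : ℝ} {F : SpaceTime → ℂ}
    (hF : IsLaplaceTransform σ 0 F) : F =ᵐ[volume] 0 := by
  obtain ⟨U, hU, mF, iF⟩ := hF
  refine ae_eq_zero_of_integral_contDiff_smul_eq_zero (f := F) ?_ fun g hg hc => ?_
  · rw [locallyIntegrable_iff]
    intro K hK
    obtain ⟨χ, hχ, hc, h1⟩ := exists_cutoff (E := SpaceTime)
    obtain ⟨R, hR⟩ := hK.isBounded.exists_norm_le
    have hR' : (0 : ℝ) < |R| + 1 := by positivity
    set a : ℝ := (|R| + 1)⁻¹ with ha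
    have ha0 : a ≠ 0 := by positivity
    have hca : HasCompactSupport (fun y : SpaceTime => χ (a • y)) :=
      hc.comp_homeomorph (Homeomorph.smulOfNeZero a ha0)
    have hsa : ContDiff ℝ (⊤ : ℕ∞) (fun y : SpaceTime => χ (a • y)) :=
      hχ.comp (contDiff_const_smul a)
    refine ((iF (hca.toSchwartzMap hsa)).1.integrableOn (s := K)).congr_fun (fun z hz => ?_)
      hK.measurableSet
    change F z * χ (a • z) = F z
    rw [h1, mul_one]
    rw [norm_smul, Real.norm_eq_abs, ha, abs_of_pos (by positivity),
      inv_mul_le_iff₀ hR', mul_one]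
    linarith [hR z hz, le_abs_self R]
  · have hc' : HasCompactSupport (fun z => ((g z : ℝ) : ℂ)) :=
      hc.comp_left (g := fun r : ℝ => (r : ℂ)) (by simp)
    have hg' : ContDiff ℝ (⊤ : ℕ∞) (fun z => ((g z : ℝ) : ℂ)) :=
      Complex.ofRealCLM.contDiff.comp hg
    have h := (iF (hc'.toSchwartzMap hg')).2
    rw [TemperedDistribution.fourier_apply, hU.apply_eq_zero] at h
    rw [h]
    refine integral_congr_ae (.of_forall fun z => ?_)
    change (g z) • F z = F z * ((g z : ℝ) : ℂ)
    rw [Complex.real_smul, mul_comm]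

/-- The Fourier-Laplace transform is unique up to null sets. -/
theorem IsLaplaceTransform.ae_eq {σ : ℝ} {u : Dist} {F H : SpaceTime → ℂ}
    (hF : IsLaplaceTransform σ u F) (hH : IsLaplaceTransform σ u H) : F =ᵐ[volume] H := by
  have h := hF.sub hH
  rw [sub_self] at h
  filter_upwards [h.ae_eq_zero] with ζ hζ
  exact sub_eq_zero.1 hζ

theorem isLaplaceTransform_laplace {σ : ℝ} {u : Dist} (h : ∃ F, IsLaplaceTransform σ u F) :
    IsLaplaceTransform σ u (laplace σ u) := by
  rw [laplace, dif_pos h]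
  exact h.choose_spec

theorem laplace_sub {σ : ℝ} {u v : Dist} (hu : ∃ F, IsLaplaceTransform σ u F)
    (hv : ∃ F, IsLaplaceTransform σ v F) :
    laplace σ (u - v) =ᵐ[volume] laplace σ u - laplace σ v :=
  have h := (isLaplaceTransform_laplace hu).sub (isLaplaceTransform_laplace hv)
  (isLaplaceTransform_laplace ⟨_, h⟩).ae_eq h

end TDBEM

noncomputable section

namespace TDBEM

/-! ### The symbol of the Dirichlet-to-Neumann operator -/

/-- With `z = a + ib`, comparing parts gives `a² - b² = k² - ξ² + σ²` and `ab = -ξσ`. If `a² < σ²`,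
the first forces `b² < ξ²`, contradicting the second; so `a² ≥ σ²`. This suffices when `k² ≤ 2ξ²`,
the case that produces the `3`; otherwise the first identity gives `a² ≥ k²/2 + σ²`. -/
theorem mul_sq_le_of_sq_eq {ξ σ k : ℝ} (hσ : 0 < σ) {z : ℂ}
    (h : z ^ 2 = (k : ℂ) ^ 2 - ((ξ : ℂ) + σ * Complex.I) ^ 2) :
    (ξ ^ 2 + σ ^ 2 + k ^ 2) * σ ^ 2 ≤ 3 * z.re ^ 2 * (ξ ^ 2 + σ ^ 2) := by
  have h1 : z.re ^ 2 - z.im ^ 2 = k ^ 2 - ξ ^ 2 + σ ^ 2 := by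
    have := congrArg Complex.re h
    simp [pow_two] at this
    linarith
  have h2 : z.re * z.im = -(ξ * σ) := by
    have := congrArg Complex.im h
    simp [pow_two] at this
    linarith
  have h3 : z.re ^ 2 * z.im ^ 2 = ξ ^ 2 * σ ^ 2 := by rw [← mul_pow, h2]; ring
  have hσ2 : σ ^ 2 ≤ z.re ^ 2 := by
    by_contra! hlt
    have hb : z.im ^ 2 < ξ ^ 2 := by nlinarith [sq_nonneg k]
    have h4 : z.re ^ 2 * z.im ^ 2 ≤ σ ^ 2 * z.im ^ 2 :=
      mul_le_mul_of_nonneg_right hlt.le (sq_nonneg _)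
    have h5 : σ ^ 2 * z.im ^ 2 < σ ^ 2 * ξ ^ 2 := mul_lt_mul_of_pos_left hb (by positivity)
    linarith
  rcases le_total (k ^ 2) (2 * ξ ^ 2) with hk | hk
  · calc (ξ ^ 2 + σ ^ 2 + k ^ 2) * σ ^ 2 ≤ (3 * (ξ ^ 2 + σ ^ 2)) * z.re ^ 2 := by
          gcongr; nlinarith [sq_nonneg σ]
      _ = _ := by ring
  · have h4 : k ^ 2 / 2 + σ ^ 2 ≤ z.re ^ 2 := by nlinarith [sq_nonneg z.im]
    have h5 : (k ^ 2 / 2 + σ ^ 2) * (ξ ^ 2 + σ ^ 2) ≤ z.re ^ 2 * (ξ ^ 2 + σ ^ 2) := by gcongr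
    have : 0 ≤ k ^ 2 * ξ ^ 2 := by positivity
    have : 0 ≤ σ ^ 2 * ξ ^ 2 := by positivity
    have : 0 ≤ k ^ 2 * σ ^ 2 := by positivity
    nlinarith [sq_nonneg (σ ^ 2)]

theorem norm_freq_sq (σ : ℝ) (ζ : SpaceTime) :
    ‖freq σ ζ‖ ^ 2 = (-(2 * Real.pi * ζ.fst)) ^ 2 + σ ^ 2 := by
  rw [freq, ← Complex.normSq_eq_norm_sq, Complex.normSq_add_mul_I]

theorem le_norm_freq (σ : ℝ) (ζ : SpaceTime) : σ ≤ ‖freq σ ζ‖ := by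
  refine abs_le_of_sq_le_sq' ?_ (norm_nonneg _) |>.2
  rw [norm_freq_sq]
  nlinarith [sq_nonneg (-(2 * Real.pi * ζ.fst))]

/-- The symbol `-iμΓ` of the Dirichlet-to-Neumann operator. -/
def dtnSymbol (σ μ : ℝ) (ζ : SpaceTime) : ℂ := -Complex.I * (μ : ℂ) * dispersion σ ζ

/-- The factors `-i` and `i` cancel and leave the principal root, whose real part is nonnegative;
coercivity is read off from it. -/
theorem dtnSymbol_eq (σ μ : ℝ) (ζ : SpaceTime) :
    dtnSymbol σ μ ζ = (μ : ℂ) * ((waveNumber ζ : ℂ) ^ 2 - freq σ ζ ^ 2) ^ (2⁻¹ : ℂ) := by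
  rw [dtnSymbol, dispersion, one_div]
  linear_combination (-(μ : ℂ) * ((waveNumber ζ : ℂ) ^ 2 - freq σ ζ ^ 2) ^ (2⁻¹ : ℂ))
    * Complex.I_mul_I

theorem sobolevWeight_half {σ : ℝ} (ζ : SpaceTime) :
    sobolevWeight σ (1 / 2) (1 / 2) ζ
      = ‖freq σ ζ‖ * √(‖freq σ ζ‖ ^ 2 + waveNumber ζ ^ 2) := by
  rw [sobolevWeight, Real.sqrt_eq_rpow]
  norm_num

theorem sobolevWeight_neg_half {σ : ℝ} (ζ : SpaceTime) :
    sobolevWeight σ (-1 / 2) (1 / 2) ζ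
      = ‖freq σ ζ‖⁻¹ * √(‖freq σ ζ‖ ^ 2 + waveNumber ζ ^ 2) := by
  rw [sobolevWeight, Real.sqrt_eq_rpow, show (2 * (-1 / 2) : ℝ) = -1 by norm_num,
    Real.rpow_neg_one]

theorem sobolevWeight_nonneg (σ s r : ℝ) (ζ : SpaceTime) : 0 ≤ sobolevWeight σ s r ζ := by
  unfold sobolevWeight; positivity

/-- The powers of `|ω|` in the two weights cancel. -/
theorem norm_dtnSymbol_le {σ μ : ℝ} (hσ : 0 < σ) (hμ : 0 < μ) (ζ : SpaceTime) :
    ‖dtnSymbol σ μ ζ‖ ≤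
      μ * (√(sobolevWeight σ (1 / 2) (1 / 2) ζ) * √(sobolevWeight σ (-1 / 2) (1 / 2) ζ)) := by
  have hN : 0 < ‖freq σ ζ‖ := hσ.trans_le (le_norm_freq σ ζ)
  rw [← Real.sqrt_mul (sobolevWeight_nonneg _ _ _ _), sobolevWeight_half, sobolevWeight_neg_half,
    mul_mul_mul_comm, mul_inv_cancel₀ hN.ne', one_mul, Real.sqrt_mul_self (Real.sqrt_nonneg _),
    dtnSymbol_eq, norm_mul, Complex.norm_real, Real.norm_of_nonneg hμ.le]
  gcongr
  apply Real.le_sqrt_of_sq_le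
  rw [← norm_pow, Complex.cpow_ofNat_inv_pow]
  refine (norm_sub_le _ _).trans (le_of_eq ?_)
  rw [norm_pow, norm_pow, Complex.norm_real, Real.norm_eq_abs, sq_abs, add_comm]

theorem le_re_dtnSymbol {σ μ : ℝ} (hσ : 0 < σ) (hμ : 0 < μ) (ζ : SpaceTime) :
    σ / √3 * μ * sobolevWeight σ (-1 / 2) (1 / 2) ζ ≤ (dtnSymbol σ μ ζ).re := by
  have hN : 0 < ‖freq σ ζ‖ := hσ.trans_le (le_norm_freq σ ζ)
  set z : ℂ := ((waveNumber ζ : ℂ) ^ 2 - freq σ ζ ^ 2) ^ (2⁻¹ : ℂ) with hz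
  have hz0 : 0 ≤ z.re := by rw [hz, Complex.cpow_inv_two_re]; positivity
  have hsq : z ^ 2 = (waveNumber ζ : ℂ) ^ 2 - freq σ ζ ^ 2 := by
    rw [hz, Complex.cpow_ofNat_inv_pow]
  have key := mul_sq_le_of_sq_eq hσ hsq
  rw [← norm_freq_sq] at key
  rw [dtnSymbol_eq, ← hz, Complex.re_ofReal_mul, sobolevWeight_neg_half]
  have h3 : (0 : ℝ) < √3 := by positivity
  have h : σ * √(‖freq σ ζ‖ ^ 2 + waveNumber ζ ^ 2) ≤ √3 * ‖freq σ ζ‖ * z.re := by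
    refine abs_le_of_sq_le_sq' ?_ (by positivity) |>.2
    rw [mul_pow, mul_pow, mul_pow, Real.sq_sqrt (by positivity), Real.sq_sqrt (by positivity)]
    linarith
  calc σ / √3 * μ * (‖freq σ ζ‖⁻¹ * √(‖freq σ ζ‖ ^ 2 + waveNumber ζ ^ 2))
      = μ * ((σ * √(‖freq σ ζ‖ ^ 2 + waveNumber ζ ^ 2)) / (√3 * ‖freq σ ζ‖)) := by
        field_simp
    _ ≤ μ * z.re := by
        gcongr
        rw [div_le_iff₀ (by positivity)]
        linarith

/-- The quotient of the weights is `|ω|⁻²`, and `|ω| ≥ σ`. -/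
theorem sobolevWeight_neg_half_le {σ : ℝ} (hσ : 0 < σ) (ζ : SpaceTime) :
    √(sobolevWeight σ (-1 / 2) (1 / 2) ζ) ≤ σ⁻¹ * √(sobolevWeight σ (1 / 2) (1 / 2) ζ) := by
  have hN : 0 < ‖freq σ ζ‖ := hσ.trans_le (le_norm_freq σ ζ)
  refine Real.sqrt_le_iff.2 ⟨by positivity, ?_⟩
  rw [mul_pow, Real.sq_sqrt (sobolevWeight_nonneg _ _ _ _), sobolevWeight_half,
    sobolevWeight_neg_half, ← mul_assoc]
  gcongr
  rw [inv_le_iff_one_le_mul₀ hN, inv_pow, mul_assoc, ← pow_two, ← div_eq_inv_mul,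
    one_le_div (by positivity)]
  exact pow_le_pow_left₀ hσ.le (le_norm_freq σ ζ) 2

theorem measurable_fst : Measurable fun ζ : SpaceTime => ζ.fst :=
  (WithLp.fstL 2 ℝ ℝ Plane).continuous.measurable

theorem measurable_freq (σ : ℝ) : Measurable (freq σ) := by
  have := measurable_fst
  unfold freq
  fun_prop

theorem measurable_waveNumber : Measurable waveNumber := by
  have : Measurable fun ζ : SpaceTime => ζ.snd := (WithLp.sndL 2 ℝ ℝ Plane).continuous.measurable
  unfold waveNumber
  fun_prop

theorem measurable_sobolevWeight (σ s r : ℝ) : Measurable (sobolevWeight σ s r) := by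
  have := measurable_freq σ
  have := measurable_waveNumber
  unfold sobolevWeight
  fun_prop

theorem measurable_dtnSymbol (σ μ : ℝ) : Measurable (dtnSymbol σ μ) := by
  have := measurable_freq σ
  have := measurable_waveNumber
  unfold dtnSymbol dispersion
  fun_prop

/-! ### The Sobolev norms as weighted `L²` norms -/

/-- The function `F` times the square root of the weight. -/
def weighted (σ s r : ℝ) (F : SpaceTime → ℂ) (ζ : SpaceTime) : ℂ :=
  (√(sobolevWeight σ s r ζ) : ℂ) * F ζ

theorem norm_weighted (σ s r : ℝ) (F : SpaceTime → ℂ) (ζ : SpaceTime) :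
    ‖weighted σ s r F ζ‖ = √(sobolevWeight σ s r ζ) * ‖F ζ‖ := by
  rw [weighted, norm_mul, Complex.norm_real, Real.norm_of_nonneg (Real.sqrt_nonneg _)]

theorem norm_weighted_sq (σ s r : ℝ) (F : SpaceTime → ℂ) (ζ : SpaceTime) :
    ‖weighted σ s r F ζ‖ ^ 2 = sobolevWeight σ s r ζ * ‖F ζ‖ ^ 2 := by
  rw [norm_weighted, mul_pow, Real.sq_sqrt (sobolevWeight_nonneg _ _ _ _)]

theorem weighted_sub (σ s r : ℝ) (F H : SpaceTime → ℂ) :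
    weighted σ s r (F - H) = weighted σ s r F - weighted σ s r H := by
  ext ζ; simp [weighted, mul_sub]

theorem weighted_congr_ae {σ s r : ℝ} {F H : SpaceTime → ℂ} (h : F =ᵐ[volume] H) :
    weighted σ s r F =ᵐ[volume] weighted σ s r H := by
  filter_upwards [h] with ζ hζ
  rw [weighted, weighted, hζ]

theorem aestronglyMeasurable_weighted {σ s r : ℝ} {F : SpaceTime → ℂ}
    (hF : AEStronglyMeasurable F volume) :
    AEStronglyMeasurable (weighted σ s r F) volume :=
  AEStronglyMeasurable.mul (Complex.measurable_ofReal.comp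
    (measurable_sobolevWeight σ s r).sqrt).aestronglyMeasurable hF

theorem eLpNorm_weighted (σ s r : ℝ) (F : SpaceTime → ℂ) :
    eLpNorm (weighted σ s r F) 2 volume
      = (∫⁻ ζ, ENNReal.ofReal (sobolevWeight σ s r ζ * ‖F ζ‖ ^ 2)) ^ (1 / 2 : ℝ) := by
  have h := eLpNorm_nnreal_eq_lintegral (μ := (volume : Measure SpaceTime))
    (f := weighted σ s r F) (p := 2) two_ne_zero
  simp only [ENNReal.coe_ofNat, NNReal.coe_ofNat] at h
  rw [h]
  congr 2
  ext ζ
  rw [← norm_weighted_sq, ENNReal.ofReal_pow (norm_nonneg _), ofReal_norm,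
    ← ENNReal.rpow_natCast]
  norm_num

/-- By uniqueness the infimum runs over a single class modulo null sets. -/
theorem sobolevNorm_eq {σ s r : ℝ} {u : Dist} (hu : ∃ F, IsLaplaceTransform σ u F) :
    sobolevNorm σ s r u = eLpNorm (weighted σ s r (laplace σ u)) 2 volume := by
  simp only [sobolevNorm, ← eLpNorm_weighted]
  refine le_antisymm (iInf₂_le _ (isLaplaceTransform_laplace hu)) (le_iInf₂ fun F hF => ?_)
  exact (eLpNorm_congr_ae
    (weighted_congr_ae ((isLaplaceTransform_laplace hu).ae_eq hF))).le

theorem exists_isLaplaceTransform {σ s r : ℝ} {u : Dist} (h : sobolevNorm σ s r u < ⊤) :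
    ∃ F, IsLaplaceTransform σ u F := by
  by_contra! hn
  simp [sobolevNorm, hn] at h

theorem aestronglyMeasurable_laplace {σ : ℝ} {u : Dist}
    (hu : ∃ F, IsLaplaceTransform σ u F) :
    AEStronglyMeasurable (laplace σ u) volume :=
  (isLaplaceTransform_laplace hu).choose_spec.2.1

theorem memLp_weighted_laplace {σ s r : ℝ} {u : Dist} (h : sobolevNorm σ s r u < ⊤) :
    MemLp (weighted σ s r (laplace σ u)) 2 volume :=
  ⟨aestronglyMeasurable_weighted (aestronglyMeasurable_laplace (exists_isLaplaceTransform h)),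
    sobolevNorm_eq (exists_isLaplaceTransform h) ▸ h⟩

theorem sobolevNorm_sub_le {σ s r : ℝ} {u v : Dist} (hu : sobolevNorm σ s r u < ⊤)
    (hv : sobolevNorm σ s r v < ⊤) :
    sobolevNorm σ s r (u - v) ≤ sobolevNorm σ s r u + sobolevNorm σ s r v := by
  have lu := exists_isLaplaceTransform hu
  have lv := exists_isLaplaceTransform hv
  rw [sobolevNorm_eq lu, sobolevNorm_eq lv,
    sobolevNorm_eq ⟨_, (isLaplaceTransform_laplace lu).sub (isLaplaceTransform_laplace lv)⟩,
    eLpNorm_congr_ae (weighted_congr_ae (laplace_sub lu lv)), weighted_sub]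
  exact eLpNorm_sub_le (memLp_weighted_laplace hu).1 (memLp_weighted_laplace hv).1 one_le_two

theorem sobolevNorm_neg_half_le {σ : ℝ} (hσ : 0 < σ) {u : Dist}
    (hu : ∃ F, IsLaplaceTransform σ u F) :
    sobolevNorm σ (-1 / 2) (1 / 2) u
      ≤ ENNReal.ofReal σ⁻¹ * sobolevNorm σ (1 / 2) (1 / 2) u := by
  rw [sobolevNorm_eq hu, sobolevNorm_eq hu]
  refine eLpNorm_le_mul_eLpNorm_of_ae_le_mul (.of_forall fun ζ => ?_) 2
  rw [norm_weighted, norm_weighted, ← mul_assoc]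
  exact mul_le_mul_of_nonneg_right (sobolevWeight_neg_half_le hσ ζ) (norm_nonneg _)

theorem sobolevNorm_neg_half_lt_top {σ : ℝ} (hσ : 0 < σ) {u : Dist}
    (hu : sobolevNorm σ (1 / 2) (1 / 2) u < ⊤) : sobolevNorm σ (-1 / 2) (1 / 2) u < ⊤ :=
  (sobolevNorm_neg_half_le hσ (exists_isLaplaceTransform hu)).trans_lt
    (ENNReal.mul_lt_top ENNReal.ofReal_lt_top hu)

/-! ### Closure properties of the spaces -/

theorem HTilde.sub_mem {σ s r : ℝ} {G : Set Plane} {u v : Dist} (hu : u ∈ HTilde σ s r G)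
    (hv : v ∈ HTilde σ s r G) : u - v ∈ HTilde σ s r G := by
  refine ⟨fun z hz => ?_, (sobolevNorm_sub_le hu.2 hv.2).trans_lt
    (ENNReal.add_lt_top.2 ⟨hu.2, hv.2⟩)⟩
  by_contra hn
  obtain ⟨s₁, h₁, o₁, z₁⟩ := (notMem_dsupport_iff z).1 fun h => hn (hu.1 h)
  obtain ⟨s₂, h₂, o₂, z₂⟩ := (notMem_dsupport_iff z).1 fun h => hn (hv.1 h)
  refine (notMem_dsupport_iff z).2 ⟨s₁ ∩ s₂, fun φ hφ => ?_, o₁.inter o₂, z₁, z₂⟩ hz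
  change u φ - v φ = 0
  rw [h₁ φ (hφ.trans Set.inter_subset_left), h₂ φ (hφ.trans Set.inter_subset_right), sub_zero]

theorem HTilde.mem_neg_half {σ : ℝ} (hσ : 0 < σ) {G : Set Plane} {u : Dist}
    (hu : u ∈ HTilde σ (1 / 2) (1 / 2) G) : u ∈ HTilde σ (-1 / 2) (1 / 2) G :=
  ⟨hu.1, sobolevNorm_neg_half_lt_top hσ hu.2⟩

/-- Ensures integrability against test functions, so that the integrals representing two discrete
functions can be subtracted. -/
theorem TensorSpace.continuous {K : Geometry.SimplicialComplex ℝ Plane} {G : Set Plane} {dt : ℝ}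
    {N : ℕ∞} {p q : ℕ} {w : SpaceTime → ℂ} (hw : w ∈ TensorSpace K G dt N p q) :
    Continuous w := by
  induction hw using Submodule.span_induction with
  | mem w h =>
    obtain ⟨v, hv, ψ, hψ, rfl⟩ := h
    exact (hv.1.comp (WithLp.fstL 2 ℝ ℝ Plane).continuous).mul
      (hψ.1.comp (WithLp.sndL 2 ℝ ℝ Plane).continuous)
  | zero => exact continuous_const
  | add _ _ _ _ hx hy => exact hx.add hy
  | smul a _ _ hx => exact hx.const_smul a

theorem DiscreteSpace.sub_mem {σ : ℝ} {K : Geometry.SimplicialComplex ℝ Plane} {G : Set Plane}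
    {dt : ℝ} {N : ℕ∞} {p q : ℕ} {u v : Dist} (hu : u ∈ DiscreteSpace σ K G dt N p q)
    (hv : v ∈ DiscreteSpace σ K G dt N p q) : u - v ∈ DiscreteSpace σ K G dt N p q := by
  obtain ⟨hu, w, hw, ew⟩ := hu
  obtain ⟨hv, y, hy, ey⟩ := hv
  refine ⟨HTilde.sub_mem hu hv, w - y, Submodule.sub_mem _ hw hy, fun φ => ?_⟩
  have hint : ∀ x : SpaceTime → ℂ, Continuous x →
      Integrable (fun z => ((φ z : ℝ) : ℂ) * x z) volume := fun x hx =>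
    ((Complex.continuous_ofReal.comp φ.continuous).mul hx).integrable_of_hasCompactSupport
      (φ.hasCompactSupport.comp_left (g := fun r : ℝ => (r : ℂ)) (by simp)).mul_right
  change u φ - v φ = _
  rw [ew, ey, ← integral_sub (hint w (TensorSpace.continuous hw))
    (hint y (TensorSpace.continuous hy))]
  simp [mul_sub]

/-! ### The sesquilinear form -/

theorem dtnForm_eq (σ μ : ℝ) (u v : Dist) :
    dtnForm σ μ u v = ∫ ζ, dtnSymbol σ μ ζ * laplace σ u ζ * conj (laplace σ v ζ) := rfl

theorem norm_dtn_integrand_le {σ μ : ℝ} (hσ : 0 < σ) (hμ : 0 < μ) (F H : SpaceTime → ℂ)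
    (ζ : SpaceTime) :
    ‖dtnSymbol σ μ ζ * F ζ * conj (H ζ)‖
      ≤ μ * ‖(weighted σ (1 / 2) (1 / 2) F • weighted σ (-1 / 2) (1 / 2) H) ζ‖ := by
  rw [Pi.smul_apply', norm_smul, norm_weighted, norm_weighted, norm_mul, norm_mul,
    RCLike.norm_conj]
  calc _ ≤ μ * (√(sobolevWeight σ (1 / 2) (1 / 2) ζ) * √(sobolevWeight σ (-1 / 2) (1 / 2) ζ))
          * ‖F ζ‖ * ‖H ζ‖ := by
        gcongr; exact norm_dtnSymbol_le hσ hμ ζ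
    _ = _ := by ring

theorem integrable_dtn {σ μ : ℝ} (hσ : 0 < σ) (hμ : 0 < μ) {u v : Dist}
    (hu : sobolevNorm σ (1 / 2) (1 / 2) u < ⊤) (hv : sobolevNorm σ (-1 / 2) (1 / 2) v < ⊤) :
    Integrable (fun ζ => dtnSymbol σ μ ζ * laplace σ u ζ * conj (laplace σ v ζ)) volume := by
  have h : Integrable (weighted σ (1 / 2) (1 / 2) (laplace σ u) •
      weighted σ (-1 / 2) (1 / 2) (laplace σ v)) volume :=
    memLp_one_iff_integrable.1 ((memLp_weighted_laplace hv).smul (memLp_weighted_laplace hu))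
  refine (h.norm.const_mul μ).mono' ?_ (.of_forall fun ζ => norm_dtn_integrand_le hσ hμ _ _ ζ)
  exact (((measurable_dtnSymbol σ μ).aestronglyMeasurable.mul
    (aestronglyMeasurable_laplace (exists_isLaplaceTransform hu))).mul
    (Complex.continuous_conj.comp_aestronglyMeasurable
      (aestronglyMeasurable_laplace (exists_isLaplaceTransform hv))))

/-- Continuity of the Dirichlet-to-Neumann form. -/
theorem enorm_dtnForm_le {σ μ : ℝ} (hσ : 0 < σ) (hμ : 0 < μ) {u v : Dist}
    (hu : sobolevNorm σ (1 / 2) (1 / 2) u < ⊤) (hv : sobolevNorm σ (-1 / 2) (1 / 2) v < ⊤) :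
    ‖dtnForm σ μ u v‖ₑ ≤ ENNReal.ofReal μ *
      (sobolevNorm σ (1 / 2) (1 / 2) u * sobolevNorm σ (-1 / 2) (1 / 2) v) := by
  rw [dtnForm_eq, sobolevNorm_eq (exists_isLaplaceTransform hu),
    sobolevNorm_eq (exists_isLaplaceTransform hv)]
  refine (enorm_integral_le_lintegral_enorm _).trans ?_
  rw [← eLpNorm_one_eq_lintegral_enorm]
  refine (eLpNorm_le_mul_eLpNorm_of_ae_le_mul
    (.of_forall fun ζ => norm_dtn_integrand_le hσ hμ _ _ ζ) 1).trans ?_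
  gcongr
  exact eLpNorm_smul_le_mul_eLpNorm (memLp_weighted_laplace hv).1 (memLp_weighted_laplace hu).1

theorem dtnForm_sub_left {σ μ : ℝ} (hσ : 0 < σ) (hμ : 0 < μ) {u u' v : Dist}
    (hu : sobolevNorm σ (1 / 2) (1 / 2) u < ⊤) (hu' : sobolevNorm σ (1 / 2) (1 / 2) u' < ⊤)
    (hv : sobolevNorm σ (-1 / 2) (1 / 2) v < ⊤) :
    dtnForm σ μ (u - u') v = dtnForm σ μ u v - dtnForm σ μ u' v := by
  rw [dtnForm_eq, dtnForm_eq, dtnForm_eq,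
    ← integral_sub (integrable_dtn hσ hμ hu hv) (integrable_dtn hσ hμ hu' hv)]
  refine integral_congr_ae ?_
  filter_upwards [laplace_sub (exists_isLaplaceTransform hu) (exists_isLaplaceTransform hu')]
    with ζ hζ
  rw [hζ, Pi.sub_apply]
  ring

/-- Coercivity of the Dirichlet-to-Neumann form. -/
theorem le_enorm_dtnForm_self {σ μ : ℝ} (hσ : 0 < σ) (hμ : 0 < μ) {u : Dist}
    (hu : sobolevNorm σ (1 / 2) (1 / 2) u < ⊤) :
    ENNReal.ofReal (σ / √3 * μ) * sobolevNorm σ (-1 / 2) (1 / 2) u ^ 2 ≤ ‖dtnForm σ μ u u‖ₑ := by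
  have hu' := sobolevNorm_neg_half_lt_top hσ hu
  have hI := integrable_dtn hσ hμ hu hu'
  have hc : 0 ≤ σ / √3 * μ := by positivity
  have hpt : ∀ ζ, σ / √3 * μ * (sobolevWeight σ (-1 / 2) (1 / 2) ζ * ‖laplace σ u ζ‖ ^ 2)
      ≤ (dtnSymbol σ μ ζ * laplace σ u ζ * conj (laplace σ u ζ)).re := fun ζ => by
    rw [mul_assoc (dtnSymbol σ μ ζ), Complex.mul_conj, Complex.re_mul_ofReal,
      Complex.normSq_eq_norm_sq, ← mul_assoc]
    exact mul_le_mul_of_nonneg_right (le_re_dtnSymbol hσ hμ ζ) (sq_nonneg _)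
  have hpos : ∀ ζ, 0 ≤ sobolevWeight σ (-1 / 2) (1 / 2) ζ * ‖laplace σ u ζ‖ ^ 2 := fun ζ =>
    mul_nonneg (sobolevWeight_nonneg _ _ _ _) (sq_nonneg _)
  calc ENNReal.ofReal (σ / √3 * μ) * sobolevNorm σ (-1 / 2) (1 / 2) u ^ 2
      = ENNReal.ofReal (σ / √3 * μ) *
        ∫⁻ ζ, ENNReal.ofReal (sobolevWeight σ (-1 / 2) (1 / 2) ζ * ‖laplace σ u ζ‖ ^ 2) := by
        rw [sobolevNorm_eq (exists_isLaplaceTransform hu), eLpNorm_weighted,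
          ← ENNReal.rpow_natCast, ← ENNReal.rpow_mul]
        norm_num
    _ = ∫⁻ ζ, ENNReal.ofReal
          (σ / √3 * μ * (sobolevWeight σ (-1 / 2) (1 / 2) ζ * ‖laplace σ u ζ‖ ^ 2)) := by
        rw [← lintegral_const_mul' _ _ ENNReal.ofReal_ne_top]
        simp only [ENNReal.ofReal_mul hc]
    _ ≤ ∫⁻ ζ, ENNReal.ofReal
          (dtnSymbol σ μ ζ * laplace σ u ζ * conj (laplace σ u ζ)).re :=
        lintegral_mono fun ζ => ENNReal.ofReal_le_ofReal (hpt ζ)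
    -- The real part of the integrand is nonnegative by `hpt`, so both integrals agree.
    _ = ENNReal.ofReal (∫ ζ, (dtnSymbol σ μ ζ * laplace σ u ζ * conj (laplace σ u ζ)).re) :=
        (ofReal_integral_eq_lintegral_ofReal hI.re
          (.of_forall fun ζ => (mul_nonneg hc (hpos ζ)).trans (hpt ζ))).symm
    _ = ENNReal.ofReal (dtnForm σ μ u u).re := by
        rw [dtnForm_eq]
        exact congrArg _ (integral_re hI)
    _ ≤ ‖dtnForm σ μ u u‖ₑ := by
        rw [← ofReal_norm]
        exact ENNReal.ofReal_le_ofReal (Complex.re_le_norm _)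

/-- Distance of the Galerkin solution to an arbitrary element of the discrete space. -/
theorem sobolevNorm_galerkin_sub_le {σ μ : ℝ} (hσ : 0 < σ) (hμ : 0 < μ) {G : Set Plane}
    {K : Geometry.SimplicialComplex ℝ Plane} {dt : ℝ} {N : ℕ∞} {p q : ℕ} {h u uh φ : Dist}
    (hu : IsContinuousSolution σ μ G h u) (huh : IsGalerkinSolution σ μ K G dt N p q h uh)
    (hφ : φ ∈ DiscreteSpace σ K G dt N p q) :
    sobolevNorm σ (-1 / 2) (1 / 2) (uh - φ)
      ≤ ENNReal.ofReal (√3 / σ) * sobolevNorm σ (1 / 2) (1 / 2) (u - φ) := by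
  have he := DiscreteSpace.sub_mem huh.1 hφ
  have hufin := (HTilde.sub_mem hu.1 hφ.1).2
  have hefin := sobolevNorm_neg_half_lt_top hσ he.1.2
  -- Galerkin orthogonality: `uh - φ` is admissible in both variational problems, so `h` drops out.
  have horth : dtnForm σ μ (uh - φ) (uh - φ) = dtnForm σ μ (u - φ) (uh - φ) := by
    rw [dtnForm_sub_left hσ hμ huh.1.1.2 hφ.1.2 hefin, dtnForm_sub_left hσ hμ hu.1.2 hφ.1.2 hefin,
      huh.2 _ he, hu.2 _ (HTilde.mem_neg_half hσ he.1)]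
  have key := (le_enorm_dtnForm_self hσ hμ he.1.2).trans
    (horth ▸ enorm_dtnForm_le hσ hμ hufin hefin)
  generalize sobolevNorm σ (1 / 2) (1 / 2) (u - φ) = A at *
  generalize sobolevNorm σ (-1 / 2) (1 / 2) (uh - φ) = B at *
  lift A to ℝ≥0 using hufin.ne
  lift B to ℝ≥0 using hefin.ne
  have key' : σ / √3 * μ * (B : ℝ) ^ 2 ≤ μ * (A * B) := by
    have := ENNReal.toReal_mono (by finiteness) key
    simpa [ENNReal.toReal_ofReal (show 0 ≤ σ / √3 * μ by positivity), hμ.le] using this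
  have hreal : (B : ℝ) ≤ √3 / σ * A := by
    -- The factor `μ B` is cancelled below, so `B = 0` is treated apart.
    rcases B.2.eq_or_lt with h0 | h0
    · change 0 = (B : ℝ) at h0
      rw [← h0]; positivity
    · change 0 < (B : ℝ) at h0
      have h1 : (μ * B) * (σ / √3 * B) ≤ (μ * B) * A := by linarith
      have h2 := le_of_mul_le_mul_left h1 (by positivity)
      rw [div_mul_eq_mul_div, div_le_iff₀ (by positivity)] at h2
      rw [div_mul_eq_mul_div, le_div_iff₀ hσ]
      linarith
  rw [← ENNReal.ofReal_coe_nnreal (p := A), ← ENNReal.ofReal_coe_nnreal (p := B),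
    ← ENNReal.ofReal_mul (by positivity)]
  exact ENNReal.ofReal_le_ofReal hreal

end TDBEM

end

/-- A priori error estimate for the Galerkin approximation of the Dirichlet-to-Neumann equation
`p_Q S_σ u = h`. The constant depends only on `σ`. -/
theorem theorem5p3 (σ : ℝ) (hσ : 0 < σ) :
    ∃ C : ℝ≥0, ∀ (μ : ℝ), 0 < μ →
      ∀ (G : Set TDBEM.Plane), TDBEM.IsLipschitzDomain G → Bornology.IsBounded G →
      ∀ (K : Geometry.SimplicialComplex ℝ TDBEM.Plane), TDBEM.IsTriangulation K G →
      ∀ (dt : ℝ), 0 < dt → ∀ (N : ℕ∞) (p q : ℕ), 1 ≤ p → 1 ≤ q →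
      ∀ h ∈ TDBEM.HQuot σ (1 / 2) (-1 / 2) G, ∀ u uh : TDBEM.Dist,
        TDBEM.IsContinuousSolution σ μ G h u →
        TDBEM.IsGalerkinSolution σ μ K G dt N p q h uh →
        TDBEM.sobolevNorm σ (-1 / 2) (1 / 2) (u - uh) ≤
          C * ⨅ φ ∈ TDBEM.DiscreteSpace σ K G dt N p q,
            TDBEM.sobolevNorm σ (1 / 2) (1 / 2) (u - φ) := by
  -- The first summand bounds `u - φ` in the weaker norm, the second bounds `uh - φ`.
  refine ⟨Real.toNNReal σ⁻¹ + Real.toNNReal (√3 / σ), ?_⟩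
  intro μ hμ G _ _ K _ dt _ N p q _ _ h _ u uh hu huh
  -- A finite nonzero constant may be moved inside an infimum in `ℝ≥0∞`, even an empty one.
  have hC : ((Real.toNNReal σ⁻¹ + Real.toNNReal (√3 / σ) : ℝ≥0) : ℝ≥0∞) ≠ 0 := by
    have : 0 < Real.toNNReal σ⁻¹ := Real.toNNReal_pos.2 (by positivity)
    exact ENNReal.coe_ne_zero.2 (by positivity)
  rw [ENNReal.mul_iInf_of_ne hC ENNReal.coe_ne_top]
  refine le_iInf fun φ => ?_
  rw [ENNReal.mul_iInf_of_ne hC ENNReal.coe_ne_top]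
  refine le_iInf fun hφ => ?_
  have huφ := (TDBEM.HTilde.sub_mem hu.1 hφ.1).2
  have huhφ := (TDBEM.HTilde.sub_mem huh.1.1 hφ.1).2
  rw [ENNReal.coe_add, add_mul, ← sub_sub_sub_cancel_right u uh φ]
  exact (TDBEM.sobolevNorm_sub_le (TDBEM.sobolevNorm_neg_half_lt_top hσ huφ)
    (TDBEM.sobolevNorm_neg_half_lt_top hσ huhφ)).trans (add_le_add
      (TDBEM.sobolevNorm_neg_half_le hσ (TDBEM.exists_isLaplaceTransform huφ))
      (TDBEM.sobolevNorm_galerkin_sub_le hσ hμ hu huh hφ))
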